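/- Let $V$ be a real vector space with a symmetric bilinear form $(\cdot,\cdot)$, and let $\Pi\subset V$ be a finite set such that $(V,(\cdot,\cdot),\Pi)$ is a root basis, that is: $(\alpha,\alpha)=1$ for all $\alpha\in\Pi$; for all $\alpha\neq\beta$ in $\Pi$, either $(\alpha,\beta)=-\cos(\pi/m)$ for some integer $m\ge 2$ or $(\alpha,\beta)\le -1$; and there is a linear form on $V$ which is positive on every element of $\Pi$. For $\alpha\in V$ with $(\alpha,\alpha)=1$ put $r_\alpha(x)=x-2(x,\alpha)\alpha$. Let $S=\{r_\alpha : \alpha\in\Pi\}$, let $W=\langle S\rangle\subset \mathrm{GL}(V)$, and let $\Phi=\{w\alpha : w\in W,\ \alpha\in\Pi\}$ be the set of roots (one has $(\alpha,\alpha)=1$ for every root $\alpha$). Put $$\kappa=\sup\{\,|(\alpha,\beta)| : \alpha,\beta\in\Phi,\ |(\alpha,\beta)|<1\,\},$$ where $\sup\emptyset=0$. Roots are ordered by inclusion of half-spaces: to a root $\alpha=u\pi$ with $u\in W$ and $\pi\in\Pi$ corresponds the half-space bounded by the wall of $r_\alpha$ which contains the vertex $u$ of the Davis complex of $(W,S)$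 (with base vertex $1$); its set of vertices is the connected component of $u$ in the graph obtained from the Cayley graph of $(W,S)$ (with edges $\{w,ws\}$, $s\in S$) by deleting the edges $\{w,r_\alpha w\}$ inverted by $r_\alpha$. We write $\alpha\subsetneq\beta$ if the half-space (equivalently, the vertex set of the half-space) of $\alpha$ is strictly contained in that of $\beta$. A chain of roots $\alpha_0\subsetneq\alpha_1\subsetneq\dots\subsetneq\alpha_n$ is called maximally convex if every chain of roots $\beta_0\subsetneq\beta_1\subsetneq\dots\subsetneq\beta_k$ with $\beta_0=\alpha_0$ and $\beta_k=\alpha_n$ satisfies $k\le n$. **Proposition.** Let $\alpha_0\subsetneq\alpha_1\subsetneq\dots\subsetneq\alpha_n$ be a maximally convex chain of roots and let $j\in\{1,\dots,n\}$. (i) If $(\alpha_0,\alpha_{j-1})=1$, then either $(\alpha_0,\alpha_j)=1$ or $(\alpha_0,\alpha_j)\ge j(1-\kappa)$. (ii) If $(\alpha_0,\alpha_j)=1+\varepsilon$ for some $\varepsilon>0$, then $(\alpha_0,\alpha_n)>1+\frac{n}{2j}\,\varepsilon$. -/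

import Mathlib

/-- A root basis: a real vector space `V` with a symmetric bilinear form `(·, ·)` and a set `Π` of
vectors (called `simple` here) which satisfies (RB1), (RB2) and (RB3). -/
structure RootBasis (V : Type*) [AddCommGroup V] [Module ℝ V] where
  /-- the symmetric bilinear form `(·, ·)` -/
  form : LinearMap.BilinForm ℝ V
  form_symm : ∀ x y : V, form x y = form y x
  /-- the set `Π` -/
  simple : Set V
  form_self : ∀ α ∈ simple, form α α = 1
  form_ne : ∀ α ∈ simple, ∀ β ∈ simple, α ≠ β →
    (∃ m : ℕ, 2 ≤ m ∧ form α β = -Real.cos (Real.pi / (m : ℝ))) ∨ form α β ≤ -1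
  exists_pos : ∃ x : Module.Dual ℝ V, ∀ α ∈ simple, 0 < x α

namespace RootBasis

/-- The reflection `r_α : x ↦ x - 2 (x, α) α` in `GL(V)`, for a vector `α` with `(α, α) = 1`. -/
def reflection {V : Type*} [AddCommGroup V] [Module ℝ V] (E : RootBasis V) (α : V)
    (h : E.form α α = 1) : V ≃ₗ[ℝ] V :=
  Module.reflection (x := α) (f := (2 : ℝ) • E.form α) (by simp [h])

theorem reflection_apply {V : Type*} [AddCommGroup V] [Module ℝ V] (E : RootBasis V) (α : V)
    (h : E.form α α = 1) (x : V) : E.reflection α h x = x - (2 * E.form x α) • α := by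
  simp [reflection, Module.reflection_apply, E.form_symm α x]

theorem reflection_mul_self {V : Type*} [AddCommGroup V] [Module ℝ V] (E : RootBasis V) (α : V)
    (h : E.form α α = 1) : E.reflection α h * E.reflection α h = 1 := by
  ext x
  exact Module.involutive_reflection (x := α) (f := (2 : ℝ) • E.form α) (by simp [h]) x

/-- The group `W`, generated by the reflections `r_α`, `α ∈ Π`, in `GL(V)`. -/
def weylGroup {V : Type*} [AddCommGroup V] [Module ℝ V] (E : RootBasis V) :
    Subgroup (V ≃ₗ[ℝ] V) :=
  Subgroup.closure {g | ∃ (α : V) (hα : α ∈ E.simple), g = E.reflection α (E.form_self α hα)}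

/-- The set `S = {r_α | α ∈ Π}`, as a set of elements of the group `W`. -/
def simpleReflections {V : Type*} [AddCommGroup V] [Module ℝ V] (E : RootBasis V) :
    Set E.weylGroup :=
  {s | ∃ (α : V) (hα : α ∈ E.simple), (s : V ≃ₗ[ℝ] V) = E.reflection α (E.form_self α hα)}

/-- The set of roots `Φ = {w α | w ∈ W, α ∈ Π}`. -/
def roots {V : Type*} [AddCommGroup V] [Module ℝ V] (E : RootBasis V) : Set V :=
  {v | ∃ w : E.weylGroup, ∃ α ∈ E.simple, (w : V ≃ₗ[ℝ] V) α = v}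

theorem form_map {V : Type*} [AddCommGroup V] [Module ℝ V] (E : RootBasis V)
    (w : E.weylGroup) (x y : V) :
    E.form ((w : V ≃ₗ[ℝ] V) x) ((w : V ≃ₗ[ℝ] V) y) = E.form x y := by
  obtain ⟨w, hw⟩ := w
  simp only
  induction hw using Subgroup.closure_induction generalizing x y with
  | mem g hg =>
    obtain ⟨α, hα, rfl⟩ := hg
    simp only [reflection_apply, map_sub, map_smul, LinearMap.sub_apply, LinearMap.smul_apply,
      smul_eq_mul, E.form_self α hα, E.form_symm α y]
    ring
  | one => rfl
  | mul g h _ _ hg hh => rw [LinearEquiv.mul_apply, LinearEquiv.mul_apply, hg, hh]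
  | inv g _ hg =>
    have key : ∀ z, g (g⁻¹ z) = z := fun z => g.apply_symm_apply z
    rw [← hg, key, key]

theorem form_root_self {V : Type*} [AddCommGroup V] [Module ℝ V] (E : RootBasis V)
    {α : V} (hα : α ∈ E.roots) : E.form α α = 1 := by
  obtain ⟨w, π, hπ, rfl⟩ := hα
  rw [form_map, E.form_self π hπ]

theorem reflection_mem {V : Type*} [AddCommGroup V] [Module ℝ V] (E : RootBasis V)
    {α : V} (hα : α ∈ E.roots) : E.reflection α (E.form_root_self hα) ∈ E.weylGroup := by
  obtain ⟨w, π, hπ, rfl⟩ := hα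
  have key : ∀ z, (w : V ≃ₗ[ℝ] V) ((w : V ≃ₗ[ℝ] V)⁻¹ z) = z :=
    fun z => (w : V ≃ₗ[ℝ] V).apply_symm_apply z
  have hs : E.reflection π (E.form_self π hπ) ∈ E.weylGroup :=
    Subgroup.subset_closure ⟨π, hπ, rfl⟩
  have h : E.reflection ((w : V ≃ₗ[ℝ] V) π) (E.form_root_self ⟨w, π, hπ, rfl⟩) =
      (w : V ≃ₗ[ℝ] V) * E.reflection π (E.form_self π hπ) * (w : V ≃ₗ[ℝ] V)⁻¹ := by
    ext x
    rw [LinearEquiv.mul_apply, LinearEquiv.mul_apply, reflection_apply, reflection_apply,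
      map_sub, map_smul, key, ← E.form_map w _ π, key]
  rw [h]
  exact mul_mem (mul_mem w.2 hs) (inv_mem w.2)

/-- The reflection `r_α` of a root `α`, as an element of the group `W`. -/
def rootReflection {V : Type*} [AddCommGroup V] [Module ℝ V] (E : RootBasis V)
    (α : E.roots) : E.weylGroup :=
  ⟨E.reflection α (E.form_root_self α.2), E.reflection_mem α.2⟩

/-- The wall of the reflection `r_α`, seen in the Cayley graph of `(W, S)`, which is the
`1`-skeleton of the Davis complex: the fixed point set of `r_α` meets the `1`-skeleton exactly in
the midpoints of the edges `{w, r_α w}` which `r_α` inverts. -/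
def wall {V : Type*} [AddCommGroup V] [Module ℝ V] (E : RootBasis V)
    (α : E.roots) : Set (Sym2 E.weylGroup) :=
  {e | e ∈ (SimpleGraph.mulCayley E.simpleReflections).edgeSet ∧
    ∃ w : E.weylGroup, e = s(w, E.rootReflection α * w)}

/-- The half-space `ζ(α)` of a root `α`, as the set of the vertices (equivalently, of the chambers)
of the Davis complex which it contains.

The base vertex is `1`. For `α_s ∈ Π` the half-space `h_s` is the one which is bounded by the wall
of `s` and contains `1` but not `s`, and `ζ` is the `W`-equivariant map with `ζ(α_s) = h_s`. So if
`α = u α_s`, then `ζ(α) = u h_s` is the side of the wall of `r_α` on which the vertex `u` lies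
(while `u s` lies on the other side): the connected component of `u` after the Cayley graph has been
cut along that wall. -/
def halfSpace {V : Type*} [AddCommGroup V] [Module ℝ V] (E : RootBasis V)
    (α : E.roots) : Set E.weylGroup :=
  {w | ∃ u : E.weylGroup, (∃ π ∈ E.simple, (u : V ≃ₗ[ℝ] V) π = (α : V)) ∧
    ((SimpleGraph.mulCayley E.simpleReflections).deleteEdges (E.wall α)).Reachable u w}

/-- The strict order `α ⊊ β` on the roots: strict inclusion of the half-spaces. -/
def StrictlyContained {V : Type*} [AddCommGroup V] [Module ℝ V] (E : RootBasis V)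
    (α β : E.roots) : Prop :=
  E.halfSpace α ⊂ E.halfSpace β

/-- `α_0 ⊊ α_1 ⊊ ⋯ ⊊ α_n` is a chain of roots. -/
def IsRootChain {V : Type*} [AddCommGroup V] [Module ℝ V] (E : RootBasis V)
    (n : ℕ) (α : Fin (n + 1) → E.roots) : Prop :=
  ∀ i : Fin n, E.StrictlyContained (α i.castSucc) (α i.succ)

/-- The chain `α_0 ⊊ ⋯ ⊊ α_n` is maximally convex: every chain `β_0 ⊊ ⋯ ⊊ β_k` with `β_0 = α_0`
and `β_k = α_n` has `k ≤ n`. -/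
def IsMaximallyConvex {V : Type*} [AddCommGroup V] [Module ℝ V] (E : RootBasis V)
    (n : ℕ) (α : Fin (n + 1) → E.roots) : Prop :=
  E.IsRootChain n α ∧
    ∀ (k : ℕ) (β : Fin (k + 1) → E.roots), E.IsRootChain k β →
      β 0 = α 0 → β (Fin.last k) = α (Fin.last n) → k ≤ n

/-- The constant `κ = sup {|(α, β)| : α, β ∈ Φ, |(α, β)| < 1}`. The set is bounded by `1`; if it is
empty, the supremum (of a set of non-negative numbers) is `0`. -/
noncomputable def kappa {V : Type*} [AddCommGroup V] [Module ℝ V] (E : RootBasis V) : ℝ :=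
  sSup {t : ℝ | ∃ α β : E.roots, t = |E.form (α : V) (β : V)| ∧ t < 1}

end RootBasis

/-!
The half-space of a root `ρ` is described by signs: a chamber `w` lies in it if and only if a fixed
linear form `x`, positive on the simple roots, is positive at `w⁻¹ ρ` (`mem_halfSpace_iff`). Behind
this is the classical fact that every root is a combination of simple roots with coefficients of one
sign (`smul_mem_posCone_of_len_le`); it is proved by the usual reduction to dihedral groups, with the
cone spanned by the simple roots in place of coordinates, as these may be linearly dependent. It
follows that adjacent chambers are separated by one wall only and that two chambers are separated by
finitely many (`finite_separating`), and folding a gallery along a wall shows that the sides of the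
wall are connected.

Nestedness of half-spaces can then be read off from the form. Nested half-spaces have product at
least `1`, as otherwise `r_α r_β` would act on the plane of the two roots as a rotation
(`one_le_form_of_subset`). Conversely, roots with product at least `1` are nested up to order, as
otherwise infinitely many walls of the dihedral group would separate two chambers
(`subset_or_subset_of_one_le_form`). Moreover products are monotone along chains: for
`α ⊊ β ⊊ γ` one has `(α, β) ≤ (α, γ)` and `(β, γ) ≤ (α, γ)`. For this, all values of `γ - β` at
chambers are non-negative (`StrictlyContained.val_le`), which would fail after sufficiently many
applications of `r_α r_β` if `(α, γ - β)` were negative.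

The two assertions result from inserting flipped roots `-r_α β` into the chain. As long as
`(α_0, α_i) = 1`, maximality forces the flip of `α_{i-1}` at `α_i` to be `α_{i+1}`, so that these
`α_i` form an arithmetic progression (`IsMaxChain.flip_eq`). If `(α_0, α_j) ≠ 1` for the next index
`j`, the flip of `α_{j-2}` at `α_{j-1}` is not nested with `α_j`, so its product with `α_j` is less
than `1`, hence at most `κ`. This makes the arithmetic progression of the products `(α_i, α_j)`,
`i < j`, drop by at least `1 - κ` at every step. For the second assertion, comparing `α_{2k}` with
the flip of `α_0` at `α_k` shows that `(α_0, α_{2k}) - 1` is at least twice `(α_0, α_k) - 1`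
(`IsMaxChain.two_mul_form_sub_one_le`), and there is a power of two above `n / (2 j)` which is
at most `n / j`.
-/

namespace RootBasis

open scoped NNReal

variable {V : Type*} [AddCommGroup V] [Module ℝ V] (E : RootBasis V)

/-- The simple reflection `r_π`, `π ∈ Π`, as an element of the group `W`. -/
def gen (π : E.simple) : E.weylGroup :=
  ⟨E.reflection π (E.form_self π π.2), Subgroup.subset_closure ⟨π, π.2, rfl⟩⟩

theorem gen_smul (π : E.simple) (v : V) :
    E.gen π • v = v - (2 * E.form v π) • (π : V) :=
  E.reflection_apply _ (E.form_self π π.2) v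

theorem gen_mul_self (π : E.simple) : E.gen π * E.gen π = 1 :=
  Subtype.ext (E.reflection_mul_self _ (E.form_self π π.2))

theorem gen_inv (π : E.simple) : (E.gen π)⁻¹ = E.gen π :=
  inv_eq_of_mul_eq_one_left (E.gen_mul_self π)

theorem gen_smul_self (π : E.simple) : E.gen π • (π : V) = -(π : V) := by
  rw [gen_smul, E.form_self π π.2]
  module

theorem form_smul (w : E.weylGroup) (v v' : V) : E.form (w • v) (w • v') = E.form v v' :=
  E.form_map w v v'

theorem form_simple_nonpos {α β : V} (hα : α ∈ E.simple) (hβ : β ∈ E.simple) (h : α ≠ β) :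
    E.form α β ≤ 0 := by
  rcases E.form_ne α hα β hβ h with ⟨m, hm, h⟩ | h
  · rw [h, neg_nonpos]
    have hm' : (2 : ℝ) ≤ m := by exact_mod_cast hm
    refine Real.cos_nonneg_of_mem_Icc ⟨?_, ?_⟩
    · have : 0 ≤ Real.pi / m := by positivity
      linarith [Real.pi_pos]
    · exact div_le_div_of_nonneg_left Real.pi_pos.le (by norm_num) hm'
  · linarith

/-! ### Words in the simple reflections -/

theorem exists_word (w : E.weylGroup) : ∃ l : List E.simple, (l.map E.gen).prod = w := by
  obtain ⟨w, hw⟩ := w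
  induction hw using Subgroup.closure_induction with
  | mem g hg =>
    obtain ⟨α, hα, rfl⟩ := hg
    exact ⟨[⟨α, hα⟩], by simp [gen]⟩
  | one => exact ⟨[], rfl⟩
  | mul g h hg' hh' hg hh =>
    obtain ⟨l, hl⟩ := hg
    obtain ⟨l', hl'⟩ := hh
    exact ⟨l ++ l', by rw [List.map_append, List.prod_append, hl, hl']; rfl⟩
  | inv g hg' hg =>
    obtain ⟨l, hl⟩ := hg
    refine ⟨l.reverse, ?_⟩
    have : ((l.map E.gen).prod)⁻¹ = (l.reverse.map E.gen).prod := by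
      rw [List.prod_inv_reverse, List.map_map, List.map_reverse]
      simp [Function.comp_def, gen_inv]
    rw [← this, hl]
    rfl

/-- The word length of `w ∈ W` with respect to the simple reflections. -/
noncomputable def len (w : E.weylGroup) : ℕ :=
  sInf {n | ∃ l : List E.simple, l.length = n ∧ (l.map E.gen).prod = w}

theorem exists_reduced_word (w : E.weylGroup) :
    ∃ l : List E.simple, l.length = E.len w ∧ (l.map E.gen).prod = w := by
  obtain ⟨l, hl⟩ := E.exists_word w
  exact Nat.sInf_mem (s := {n | ∃ l : List E.simple, l.length = n ∧ (l.map E.gen).prod = w})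
    ⟨l.length, l, rfl, hl⟩

theorem len_prod_le (l : List E.simple) : E.len (l.map E.gen).prod ≤ l.length :=
  Nat.sInf_le ⟨l, rfl, rfl⟩

theorem len_mul_gen_le (w : E.weylGroup) (s : E.simple) : E.len (w * E.gen s) ≤ E.len w + 1 := by
  obtain ⟨l, hl, hw⟩ := E.exists_reduced_word w
  have := E.len_prod_le (l ++ [s])
  simpa [hw, hl] using this

theorem len_le_len_mul_gen (w : E.weylGroup) (s : E.simple) :
    E.len w ≤ E.len (w * E.gen s) + 1 := by
  have := E.len_mul_gen_le (w * E.gen s) s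
  rwa [mul_assoc, gen_mul_self, mul_one] at this

theorem eq_one_of_len_eq_zero {w : E.weylGroup} (h : E.len w = 0) : w = 1 := by
  obtain ⟨l, hl, hw⟩ := E.exists_reduced_word w
  rw [h, List.length_eq_zero_iff] at hl
  simpa [hl] using hw.symm

theorem exists_right_descent {w : E.weylGroup} (h : E.len w ≠ 0) :
    ∃ t : E.simple, E.len (w * E.gen t) + 1 = E.len w := by
  obtain ⟨l, hl, hw⟩ := E.exists_reduced_word w
  rcases l.eq_nil_or_concat with rfl | ⟨l, t, rfl⟩
  · exact absurd hl.symm h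
  · refine ⟨t, le_antisymm ?_ (E.len_le_len_mul_gen w t)⟩
    have := E.len_prod_le l
    rw [← hl, ← hw]
    simpa [mul_assoc, gen_mul_self] using this

/-! ### Alternating words in two simple reflections -/

/-- The letter at place `k`, counted from the right, of an alternating word which ends in `t`. -/
def letter (s t : E.simple) (k : ℕ) : E.simple := if Even k then t else s

theorem letter_succ (s t : E.simple) (k : ℕ) : E.letter s t (k + 1) = E.letter t s k := by
  by_cases h : Even k <;> simp [letter, h, Nat.even_add_one]

/-- The product `⋯ r_s r_t` of the alternating word with `k` letters which ends in `t`. -/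
def alt (s t : E.simple) : ℕ → E.weylGroup
  | 0 => 1
  | k + 1 => E.gen (E.letter s t k) * alt s t k

theorem alt_succ' (s t : E.simple) (k : ℕ) : E.alt s t (k + 1) = E.alt t s k * E.gen t := by
  induction k with
  | zero => simp [alt, letter]
  | succ k ih => rw [alt, ih, letter_succ, ← mul_assoc]; rfl

theorem len_mul_alt_le (v : E.weylGroup) (s t : E.simple) (k : ℕ) :
    E.len (v * E.alt s t k) ≤ E.len v + k := by
  induction k generalizing s t with
  | zero => simp [alt]
  | succ k ih =>
    rw [alt_succ', ← mul_assoc]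
    exact (E.len_mul_gen_le _ t).trans (Nat.succ_le_succ (ih t s))

/-- The Chebyshev values `sin (k θ) / sin θ`, where `c = cos θ`, by their recursion. -/
def cheb (c : ℝ) : ℕ → ℝ
  | 0 => 0
  | 1 => 1
  | k + 2 => 2 * c * cheb c (k + 1) - cheb c k

theorem cheb_nonneg_of_one_le {c : ℝ} (hc : 1 ≤ c) (k : ℕ) : 0 ≤ cheb c k := by
  have : 0 ≤ cheb c k ∧ cheb c k ≤ cheb c (k + 1) := by
    induction k with
    | zero => simp [cheb]
    | succ k ih =>
      refine ⟨ih.1.trans ih.2, ?_⟩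
      rw [cheb]
      nlinarith [mul_nonneg (sub_nonneg.2 hc) (ih.1.trans ih.2)]
  exact this.1

theorem cheb_cos_mul_sin (θ : ℝ) (k : ℕ) : cheb (Real.cos θ) k * Real.sin θ = Real.sin (k * θ) := by
  have : cheb (Real.cos θ) k * Real.sin θ = Real.sin (k * θ) ∧
      cheb (Real.cos θ) (k + 1) * Real.sin θ = Real.sin ((k + 1 : ℕ) * θ) := by
    induction k with
    | zero => simp [cheb]
    | succ k ih =>
      refine ⟨ih.2, ?_⟩
      have h1 : ((k + 1 + 1 : ℕ) : ℝ) * θ = (k + 1 : ℕ) * θ + θ := by push_cast; ring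
      have h2 : (k : ℝ) * θ = (k + 1 : ℕ) * θ - θ := by push_cast; ring
      rw [cheb, h1, Real.sin_add]
      rw [h2, Real.sin_sub] at ih
      linear_combination 2 * Real.cos θ * ih.2 - ih.1
  exact this.1

theorem sin_pi_div_pos {m : ℕ} (hm : 2 ≤ m) : 0 < Real.sin (Real.pi / m) := by
  have hm' : (2 : ℝ) ≤ m := by exact_mod_cast hm
  refine Real.sin_pos_of_pos_of_lt_pi (by positivity) ?_
  rw [div_lt_iff₀ (by positivity)]
  nlinarith [Real.pi_pos]

theorem cheb_cos_nonneg {m k : ℕ} (hm : 2 ≤ m) (hk : k ≤ m) :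
    0 ≤ cheb (Real.cos (Real.pi / m)) k := by
  have hs := sin_pi_div_pos hm
  have hm' : (2 : ℝ) ≤ m := by exact_mod_cast hm
  have hk' : (k : ℝ) ≤ m := by exact_mod_cast hk
  refine nonneg_of_mul_nonneg_left (b := Real.sin (Real.pi / m)) ?_ hs
  rw [cheb_cos_mul_sin]
  refine Real.sin_nonneg_of_nonneg_of_le_pi (by positivity) ?_
  rw [mul_div_assoc', div_le_iff₀ (by positivity)]
  nlinarith [Real.pi_pos]

theorem alt_smul (s t : E.simple) (k : ℕ) :
    E.alt s t k • (s : V) = cheb (-E.form s t) (k + 1) • (E.letter s t (k + 1) : V) +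
      cheb (-E.form s t) k • (E.letter s t k : V) := by
  induction k with
  | zero => simp [alt, cheb, letter]
  | succ k ih =>
    have h1 : E.form (E.letter s t (k + 1)) (E.letter s t k) = E.form s t := by
      by_cases h : Even k
      · simp [letter, h, Nat.even_add_one]
      · simp [letter, h, Nat.even_add_one, E.form_symm t s]
    have h2 : E.letter s t (k + 1 + 1) = E.letter s t k := by rw [letter_succ, letter_succ]
    rw [alt, mul_smul, ih, gen_smul, h2]
    simp only [map_add, map_smul, LinearMap.add_apply, LinearMap.smul_apply, smul_eq_mul, h1,
      E.form_self _ (E.letter s t k).2]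
    rw [cheb]
    module

theorem alt_smul_of_orthogonal {s t : E.simple} {v : V} (hs : E.form v s = 0)
    (ht : E.form v t = 0) (k : ℕ) : E.alt s t k • v = v := by
  induction k with
  | zero => simp [alt]
  | succ k ih =>
    rw [alt, mul_smul, ih, gen_smul]
    by_cases h : Even k <;> simp [letter, h, hs, ht]

theorem alt_smul_eq_of_form_eq_neg_cos {s t : E.simple} {m : ℕ} (hm : 2 ≤ m)
    (h : E.form s t = -Real.cos (Real.pi / m)) :
    E.alt s t m • (s : V) = E.alt t s m • (s : V) := by
  obtain ⟨k, rfl⟩ : ∃ k, m = k + 1 := ⟨m - 1, by omega⟩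
  have hs := sin_pi_div_pos hm
  have hm0 : ((k + 1 : ℕ) : ℝ) ≠ 0 := by positivity
  set c := Real.cos (Real.pi / (k + 1 : ℕ)) with hc
  have h0 : cheb c (k + 1) = 0 := by
    refine (mul_eq_zero.1 ?_).resolve_right hs.ne'
    rw [hc, cheb_cos_mul_sin, mul_div_cancel₀ _ hm0, Real.sin_pi]
  have h1 : cheb c k = 1 := by
    refine mul_right_cancel₀ hs.ne' ?_
    have : (k : ℝ) * (Real.pi / (k + 1 : ℕ)) = Real.pi - Real.pi / (k + 1 : ℕ) := by
      field_simp
      push_cast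
      ring
    rw [hc, cheb_cos_mul_sin, this, Real.sin_pi_sub, one_mul]
  have h2 : cheb c (k + 1 + 1) = -1 := by rw [cheb, h0, h1]; ring
  have h3 : E.letter s t (k + 1 + 1) = E.letter s t k := by rw [letter_succ, letter_succ]
  have hf : -E.form s t = c := by rw [h, neg_neg]
  rw [alt_smul, E.alt_succ' t s, mul_smul, gen_smul_self, smul_neg, alt_smul, hf, h0, h1, h2, h3]
  module

/-- The braid relation. -/
theorem alt_eq_alt_of_form_eq_neg_cos {s t : E.simple} {m : ℕ} (hm : 2 ≤ m)
    (h : E.form s t = -Real.cos (Real.pi / m)) : E.alt s t m = E.alt t s m := by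
  have hs := E.alt_smul_eq_of_form_eq_neg_cos hm h
  have ht := E.alt_smul_eq_of_form_eq_neg_cos hm (s := t) (t := s) (by rw [E.form_symm, h])
  have hc : 1 - E.form s t ^ 2 ≠ 0 := by
    have := sin_pi_div_pos hm
    rw [h, neg_sq, ← Real.sin_sq]
    positivity
  refine Subtype.ext (LinearEquiv.ext fun v => ?_)
  change E.alt s t m • v = E.alt t s m • v
  -- split off the component of `v` in the plane of `s` and `t`, on which the form is definite
  set c := E.form s t
  set a := (E.form v s - c * E.form v t) / (1 - c ^ 2) with ha
  set b := (E.form v t - c * E.form v s) / (1 - c ^ 2) with hb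
  obtain ⟨u, hu⟩ : ∃ u, v = u + (a • (s : V) + b • (t : V)) :=
    ⟨v - (a • (s : V) + b • (t : V)), by abel⟩
  have hts : E.form t s = c := E.form_symm _ _
  have hss : E.form s s = 1 := E.form_self s s.2
  have htt : E.form t t = 1 := E.form_self t t.2
  have hu' : u = v - (a • (s : V) + b • (t : V)) := by rw [hu]; abel
  have h1 : E.form u s = 0 := by
    rw [hu']
    simp only [map_sub, map_add, map_smul, LinearMap.sub_apply, LinearMap.add_apply,
      LinearMap.smul_apply, smul_eq_mul, hts, hss]
    rw [ha, hb]
    field_simp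
    ring
  have h2 : E.form u t = 0 := by
    rw [hu']
    simp only [map_sub, map_add, map_smul, LinearMap.sub_apply, LinearMap.add_apply,
      LinearMap.smul_apply, smul_eq_mul, htt]
    change E.form v t - (a * c + b * 1) = 0
    rw [ha, hb]
    field_simp
    ring
  rw [hu, smul_add, smul_add, smul_add, smul_add, E.alt_smul_of_orthogonal h1 h2,
    E.alt_smul_of_orthogonal h2 h1, smul_comm _ a, smul_comm _ b, smul_comm _ a, smul_comm _ b,
    hs, ht]

/-! ### Positive and negative roots -/

/-- The cone of the linear combinations of simple roots with non-negative coefficients. -/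
def posCone : Submodule ℝ≥0 V := Submodule.span ℝ≥0 E.simple

theorem simple_mem_posCone (s : E.simple) : (s : V) ∈ E.posCone := Submodule.subset_span s.2

theorem smul_mem_posCone {a : ℝ} (ha : 0 ≤ a) {v : V} (hv : v ∈ E.posCone) :
    a • v ∈ E.posCone :=
  E.posCone.smul_mem (⟨a, ha⟩ : ℝ≥0) hv

/-- If `s` is no right descent of `w`, then `w` maps the simple root of `s` to a positive root.
A right descent `t` of `w` is followed down as far as possible in the dihedral group of `s` and `t`:
`w = v d`, where `d` is an alternating word in `s`, `t` and neither is a right descent of `v`. So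
`v` maps both simple roots into the cone by induction, and `d` maps the simple root of `s` to a
combination of both whose coefficients are Chebyshev values. -/
theorem smul_mem_posCone_of_len_le (w : E.weylGroup) (s : E.simple)
    (h : E.len w ≤ E.len (w * E.gen s)) : w • (s : V) ∈ E.posCone := by
  induction hn : E.len w using Nat.strong_induction_on generalizing w s with
  | _ n ih =>
  subst hn
  rcases eq_or_ne (E.len w) 0 with h0 | h0
  · rw [E.eq_one_of_len_eq_zero h0, one_smul]
    exact E.simple_mem_posCone s
  obtain ⟨t, ht⟩ := E.exists_right_descent h0
  have hst : s ≠ t := by rintro rfl; omega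
  have hst' : (s : V) ≠ t := fun e => hst (Subtype.ext e)
  let v : ℕ → E.weylGroup := fun k => w * (E.alt s t k)⁻¹
  have hv : ∀ k, v k * E.alt s t k = w := fun k => by simp [v]
  have hv1 : ∀ k, v k * E.gen (E.letter s t k) = v (k + 1) := fun k => by
    simp [v, alt, gen_inv, mul_assoc]
  have hv2 : ∀ k, v (k + 1) * E.gen (E.letter s t k) = v k := fun k => by
    rw [← hv1, mul_assoc, gen_mul_self, mul_one]
  have hlow : ∀ k, E.len w ≤ E.len (v k) + k := fun k => by
    have := E.len_mul_alt_le (v k) s t k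
    rwa [hv] at this
  classical
  have hex : ∃ k, E.len (v (k + 1)) + (k + 1) ≠ E.len w := ⟨E.len w, by omega⟩
  obtain ⟨k, hk, hmin⟩ : ∃ k, E.len (v (k + 1)) + (k + 1) ≠ E.len w ∧
      ∀ i < k, E.len (v (i + 1)) + (i + 1) = E.len w :=
    ⟨Nat.find hex, Nat.find_spec hex, fun i hi => not_not.1 (Nat.find_min hex hi)⟩
  have hv_one : v 1 = w * E.gen t := by simp [v, alt, letter, gen_inv]
  clear_value v
  have hk0 : k ≠ 0 := by
    rintro rfl
    rw [zero_add, hv_one] at hk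
    exact hk ht
  obtain ⟨k, rfl⟩ := Nat.exists_eq_succ_of_ne_zero hk0
  have hlen : E.len (v (k + 1)) + (k + 1) = E.len w := hmin k (Nat.lt_succ_self k)
  have hA : v (k + 1) • (E.letter s t (k + 1) : V) ∈ E.posCone := by
    refine ih _ (by omega) _ _ ?_ rfl
    rw [hv1]
    have := hlow (k + 1 + 1)
    simp only [Nat.succ_eq_add_one] at hk
    omega
  have hB : v (k + 1) • (E.letter s t (k + 1 + 1) : V) ∈ E.posCone := by
    refine ih _ (by omega) _ _ ?_ rfl
    rw [letter_succ, letter_succ, hv2]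
    have := hlow k
    omega
  rw [← hv (k + 1), mul_smul, alt_smul, smul_add, smul_comm _ (cheb _ _), smul_comm _ (cheb _ _)]
  rcases E.form_ne s s.2 t t.2 hst' with ⟨m, hm, hf⟩ | hf
  · have hkm : k + 1 + 1 ≤ m := by
      by_contra! hlt
      -- by the braid relation `w` has a reduced word which ends in `s`
      obtain ⟨i, rfl⟩ : ∃ i, m = i + 1 := ⟨m - 1, by omega⟩
      have hi := hmin i (by omega)
      have hw : w * E.gen s = v (i + 1) * E.alt s t i := by
        rw [← hv (i + 1), E.alt_eq_alt_of_form_eq_neg_cos hm hf, alt_succ', mul_assoc, mul_assoc,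
          gen_mul_self, mul_one]
      have := E.len_mul_alt_le (v (i + 1)) s t i
      rw [← hw] at this
      omega
    rw [hf, neg_neg]
    exact add_mem (E.smul_mem_posCone (cheb_cos_nonneg hm hkm) hB)
      (E.smul_mem_posCone (cheb_cos_nonneg hm (by omega)) hA)
  · have hc : 1 ≤ -E.form s t := by linarith
    exact add_mem (E.smul_mem_posCone (cheb_nonneg_of_one_le hc _) hB)
      (E.smul_mem_posCone (cheb_nonneg_of_one_le hc _) hA)

theorem smul_simple_mem_posCone_or (w : E.weylGroup) (s : E.simple) :
    w • (s : V) ∈ E.posCone ∨ -(w • (s : V)) ∈ E.posCone := by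
  rcases le_total (E.len w) (E.len (w * E.gen s)) with h | h
  · exact .inl (E.smul_mem_posCone_of_len_le w s h)
  · right
    have := E.smul_mem_posCone_of_len_le (w * E.gen s) s
      (by rwa [mul_assoc, gen_mul_self, mul_one])
    rwa [mul_smul, gen_smul_self, smul_neg] at this

theorem mem_posCone_or_neg_mem {ρ : V} (hρ : ρ ∈ E.roots) :
    ρ ∈ E.posCone ∨ -ρ ∈ E.posCone := by
  obtain ⟨w, π, hπ, rfl⟩ := hρ
  exact E.smul_simple_mem_posCone_or w ⟨π, hπ⟩

/-- A linear form which is positive on all simple roots. -/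
noncomputable def height : Module.Dual ℝ V := E.exists_pos.choose

theorem height_simple_pos {α : V} (hα : α ∈ E.simple) : 0 < E.height α :=
  E.exists_pos.choose_spec α hα

theorem height_nonneg_of_subset {T : Set V} (hT : T ⊆ E.simple) {v : V}
    (hv : v ∈ Submodule.span ℝ≥0 T) : 0 ≤ E.height v ∧ (E.height v = 0 → v = 0) := by
  induction hv using Submodule.span_induction with
  | mem v hv =>
    have := E.height_simple_pos (hT hv)
    exact ⟨this.le, fun h => absurd h this.ne'⟩
  | zero => simp
  | add v v' _ _ hv hv' =>
    rw [map_add]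
    refine ⟨add_nonneg hv.1 hv'.1, fun h => ?_⟩
    rw [hv.2 (by linarith [hv.1, hv'.1]), hv'.2 (by linarith [hv.1, hv'.1]), add_zero]
  | smul a v _ hv =>
    rw [NNReal.smul_def, map_smul, smul_eq_mul]
    refine ⟨mul_nonneg a.2 hv.1, fun h => ?_⟩
    rcases mul_eq_zero.1 h with h | h
    · rw [h, zero_smul]
    · rw [hv.2 h, smul_zero]

theorem form_nonpos_of_mem_span {s : V} (hs : s ∈ E.simple) {v : V}
    (hv : v ∈ Submodule.span ℝ≥0 (E.simple \ {s})) : E.form v s ≤ 0 := by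
  induction hv using Submodule.span_induction with
  | mem v hv => exact E.form_simple_nonpos hv.1 hs hv.2
  | zero => simp
  | add v v' _ _ hv hv' => rw [map_add, LinearMap.add_apply]; exact add_nonpos hv hv'
  | smul a v _ hv =>
    rw [NNReal.smul_def, map_smul, LinearMap.smul_apply, smul_eq_mul]
    exact mul_nonpos_of_nonneg_of_nonpos a.2 hv

/-- A simple reflection makes no positive root negative except its own simple root. The simple
roots may be linearly dependent, so coefficients cannot be compared; instead, the parts of `v` and
of its negated image off `s` add up to a multiple of `s`, which vanishes because its product
with `s` is not positive. -/
theorem eq_simple_of_gen_smul_neg {v : V} (hv : v ∈ E.posCone) (h1 : E.form v v = 1)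
    (s : E.simple) (h : -(E.gen s • v) ∈ E.posCone) : v = s := by
  have hins : E.simple = insert (s : V) (E.simple \ {(s : V)}) := by
    rw [Set.insert_sdiff_singleton, Set.insert_eq_of_mem s.2]
  have hsub : E.simple \ {(s : V)} ⊆ E.simple := Set.sdiff_subset
  rw [posCone, hins, Submodule.mem_span_insert] at hv h
  obtain ⟨a, v', hv', hva⟩ := hv
  obtain ⟨b, u', hu', hub⟩ := h
  rw [NNReal.smul_def] at hva hub
  have hsum : v' + u' = (2 * E.form v s - a - b) • (s : V) := by
    have h2 := E.gen_smul s v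
    have hu : u' = -(E.gen s • v) - (b : ℝ) • (s : V) := by rw [hub]; abel
    have hv2 : v' = v - (a : ℝ) • (s : V) := by rw [hva]; abel
    rw [hu, h2, hv2]
    module
  set τ := 2 * E.form v s - a - b
  have hτ : τ ≤ 0 := by
    have hf : E.form (v' + u') s = τ := by
      rw [hsum, map_smul, LinearMap.smul_apply, smul_eq_mul, E.form_self s s.2, mul_one]
    rw [← hf, map_add, LinearMap.add_apply]
    exact add_nonpos (E.form_nonpos_of_mem_span s.2 hv') (E.form_nonpos_of_mem_span s.2 hu')
  have hx : E.height v' + E.height u' = τ * E.height s := by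
    rw [← map_add, hsum, map_smul, smul_eq_mul]
  have hv0 := E.height_nonneg_of_subset hsub hv'
  have hu0 := E.height_nonneg_of_subset hsub hu'
  have hs0 := E.height_simple_pos s.2
  have : v' = 0 := hv0.2 (by nlinarith [hv0.1, hu0.1])
  rw [this, add_zero] at hva
  have ha : (a : ℝ) * a = 1 := by
    rw [hva] at h1
    simpa [E.form_self s s.2] using h1
  have ha' : (a : ℝ) = 1 := by nlinarith [a.2]
  rw [hva, ha', one_smul]

theorem smul_mem_roots (w : E.weylGroup) {ρ : V} (hρ : ρ ∈ E.roots) : w • ρ ∈ E.roots := by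
  obtain ⟨u, π, hπ, rfl⟩ := hρ
  exact ⟨w * u, π, hπ, rfl⟩

theorem neg_mem_roots {ρ : V} (hρ : ρ ∈ E.roots) : -ρ ∈ E.roots := by
  obtain ⟨u, π, hπ, rfl⟩ := hρ
  refine ⟨u * E.gen ⟨π, hπ⟩, π, hπ, ?_⟩
  change (u * E.gen ⟨π, hπ⟩) • π = -(u • π)
  rw [mul_smul, E.gen_smul_self ⟨π, hπ⟩, smul_neg]

theorem exists_smul_simple {ρ : V} (hρ : ρ ∈ E.roots) :
    ∃ (u : E.weylGroup) (s : E.simple), ρ = u • (s : V) := by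
  obtain ⟨u, π, hπ, rfl⟩ := hρ
  exact ⟨u, ⟨π, hπ⟩, rfl⟩

theorem rootReflection_smul (ρ : E.roots) (v : V) :
    E.rootReflection ρ • v = v - (2 * E.form v ρ) • (ρ : V) :=
  E.reflection_apply _ (E.form_root_self ρ.2) v

theorem rootReflection_mul_self (ρ : E.roots) : E.rootReflection ρ * E.rootReflection ρ = 1 :=
  Subtype.ext (E.reflection_mul_self _ (E.form_root_self ρ.2))

theorem rootReflection_inv (ρ : E.roots) : (E.rootReflection ρ)⁻¹ = E.rootReflection ρ :=
  inv_eq_of_mul_eq_one_left (E.rootReflection_mul_self ρ)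

theorem rootReflection_smul_self (ρ : E.roots) : E.rootReflection ρ • (ρ : V) = -(ρ : V) := by
  rw [rootReflection_smul, E.form_root_self ρ.2]
  module

theorem rootReflection_mul_of_eq_smul {ρ : E.roots} {u : E.weylGroup} {s : E.simple}
    (h : (ρ : V) = u • (s : V)) : E.rootReflection ρ * u = u * E.gen s := by
  refine Subtype.ext (LinearEquiv.ext fun v => ?_)
  change (E.rootReflection ρ * u) • v = (u * E.gen s) • v
  rw [mul_smul, mul_smul, rootReflection_smul, gen_smul, h, form_smul, smul_sub, smul_comm]

/-! ### Signs of roots at chambers -/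

/-- The value of a vector at the chamber `w`: the vector `v` is evaluated at the translate by `w` of
a point in the interior of the fundamental chamber of the dual space. -/
noncomputable def val (w : E.weylGroup) : Module.Dual ℝ V :=
  E.height ∘ₗ ((w⁻¹ : E.weylGroup) : V ≃ₗ[ℝ] V).toLinearMap

theorem val_apply (w : E.weylGroup) (v : V) : E.val w v = E.height (w⁻¹ • v) := rfl

theorem val_smul (w g : E.weylGroup) (v : V) : E.val w (g • v) = E.val (g⁻¹ * w) v := by
  rw [val_apply, val_apply, smul_smul, mul_inv_rev, inv_inv]

theorem mem_posCone_of_height_pos {ρ : V} (hρ : ρ ∈ E.roots) (h : 0 < E.height ρ) :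
    ρ ∈ E.posCone := by
  refine (E.mem_posCone_or_neg_mem hρ).resolve_right fun h' => ?_
  have := (E.height_nonneg_of_subset subset_rfl h').1
  rw [map_neg] at this
  linarith

theorem val_ne_zero (w : E.weylGroup) {ρ : V} (hρ : ρ ∈ E.roots) : E.val w ρ ≠ 0 := by
  intro h
  rw [val_apply] at h
  have hr := E.smul_mem_roots w⁻¹ hρ
  have h0 : w⁻¹ • ρ = 0 := by
    rcases E.mem_posCone_or_neg_mem hr with h' | h'
    · exact (E.height_nonneg_of_subset subset_rfl h').2 h
    · exact neg_eq_zero.1 ((E.height_nonneg_of_subset subset_rfl h').2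
        (by rw [map_neg, h, neg_zero]))
  have := E.form_root_self hr
  rw [h0, map_zero] at this
  simp at this

theorem val_neg_of_not_pos {w : E.weylGroup} {ρ : V} (hρ : ρ ∈ E.roots) (h : ¬ 0 < E.val w ρ) :
    E.val w ρ < 0 :=
  lt_of_le_of_ne (not_lt.1 h) (E.val_ne_zero w hρ)

theorem val_rootReflection_mul (ρ : E.roots) (w : E.weylGroup) :
    E.val (E.rootReflection ρ * w) ρ = -E.val w ρ := by
  have := E.val_smul w (E.rootReflection ρ) ρ
  rw [rootReflection_inv, rootReflection_smul_self, map_neg] at this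
  exact this.symm

/-- The only wall which separates the adjacent chambers `w` and `w r_s` is the wall of `w s`. -/
theorem eq_smul_of_val_mul_gen_neg {w : E.weylGroup} {s : E.simple} {ρ : V} (hρ : ρ ∈ E.roots)
    (h : 0 < E.val w ρ) (h' : E.val (w * E.gen s) ρ < 0) : ρ = w • (s : V) := by
  have hr := E.smul_mem_roots w⁻¹ hρ
  rw [val_apply] at h
  rw [val_apply, mul_inv_rev, gen_inv, mul_smul] at h'
  rw [← E.eq_simple_of_gen_smul_neg (E.mem_posCone_of_height_pos hr h) (E.form_root_self hr) s
    (E.mem_posCone_of_height_pos (E.neg_mem_roots (E.smul_mem_roots _ hr)) ?_), smul_inv_smul]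
  rw [map_neg]
  linarith

/-- A gallery crosses one wall at each step, so only finitely many walls separate two chambers. -/
theorem finite_separating (w w' : E.weylGroup) :
    {ρ : V | ρ ∈ E.roots ∧ 0 < E.val w ρ ∧ E.val w' ρ < 0}.Finite := by
  obtain ⟨l, hl⟩ := E.exists_word (w⁻¹ * w')
  obtain rfl : w' = w * (l.map E.gen).prod := by rw [hl, mul_inv_cancel_left]
  clear hl
  induction l using List.reverseRecOn with
  | nil =>
    refine Set.Finite.subset Set.finite_empty ?_
    rintro ρ ⟨-, h, h'⟩
    rw [List.map_nil, List.prod_nil, mul_one] at h'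
    exact absurd h h'.le.not_gt
  | append_singleton l s ih =>
    refine (ih.insert ((w * (l.map E.gen).prod) • (s : V))).subset ?_
    rintro ρ ⟨hρ, h, h'⟩
    rw [List.map_append, List.prod_append, ← mul_assoc, List.map_singleton,
      List.prod_singleton] at h'
    by_cases hp : 0 < E.val (w * (l.map E.gen).prod) ρ
    · exact Set.mem_insert_iff.2 (.inl (E.eq_smul_of_val_mul_gen_neg hρ hp h'))
    · exact Set.mem_insert_of_mem _ ⟨hρ, h, E.val_neg_of_not_pos hρ hp⟩

/-! ### Half-spaces -/

theorem gen_ne_one (s : E.simple) : E.gen s ≠ 1 := by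
  intro h
  have h1 := E.gen_smul_self s
  rw [h, one_smul] at h1
  have h2 := congrArg E.height h1
  rw [map_neg] at h2
  linarith [E.height_simple_pos s.2]

theorem mulCayley_adj_mul_gen (w : E.weylGroup) (s : E.simple) :
    (SimpleGraph.mulCayley E.simpleReflections).Adj w (w * E.gen s) := by
  rw [SimpleGraph.mulCayley_adj']
  exact ⟨fun h => E.gen_ne_one s (left_eq_mul.1 h), E.gen s, ⟨s, s.2, rfl⟩, .inl rfl⟩

theorem exists_eq_mul_gen_of_adj {w w' : E.weylGroup}
    (h : (SimpleGraph.mulCayley E.simpleReflections).Adj w w') :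
    ∃ s : E.simple, w' = w * E.gen s := by
  rw [SimpleGraph.mulCayley_adj'] at h
  obtain ⟨-, g, ⟨π, hπ, hg⟩, h⟩ := h
  obtain rfl : g = E.gen ⟨π, hπ⟩ := Subtype.ext hg
  refine ⟨⟨π, hπ⟩, ?_⟩
  rcases h with h | h
  · exact h.symm
  · rw [h, mul_assoc, gen_mul_self, mul_one]

theorem adj_deleteEdges_wall {ρ : E.roots} {w : E.weylGroup} {s : E.simple}
    (h : 0 < E.val w ρ) (h' : 0 < E.val (w * E.gen s) ρ) :
    ((SimpleGraph.mulCayley E.simpleReflections).deleteEdges (E.wall ρ)).Adj w (w * E.gen s) := by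
  rw [SimpleGraph.deleteEdges_adj]
  refine ⟨E.mulCayley_adj_mul_gen w s, ?_⟩
  rintro ⟨-, u, hu⟩
  have hr := E.val_rootReflection_mul ρ u
  rcases Sym2.eq_iff.1 hu with ⟨h1, h2⟩ | ⟨h1, h2⟩
  · rw [h1] at h
    rw [h2] at h'
    linarith
  · rw [h1] at h
    rw [h2] at h'
    linarith

open Classical in
/-- The folding of the chambers onto the positive side of the wall of `ρ`. -/
noncomputable def fold (ρ : E.roots) (w : E.weylGroup) : E.weylGroup :=
  if 0 < E.val w ρ then w else E.rootReflection ρ * w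

/-- Adjacent chambers are folded to chambers which are equal or adjacent along an edge that does not
cross the wall. -/
theorem reachable_fold_mul_gen (ρ : E.roots) (w : E.weylGroup) (s : E.simple) :
    ((SimpleGraph.mulCayley E.simpleReflections).deleteEdges (E.wall ρ)).Reachable
      (E.fold ρ w) (E.fold ρ (w * E.gen s)) := by
  unfold fold
  split_ifs with h h' h'
  · exact (E.adj_deleteEdges_wall h h').reachable
  · have := E.rootReflection_mul_of_eq_smul
      (E.eq_smul_of_val_mul_gen_neg ρ.2 h (E.val_neg_of_not_pos ρ.2 h'))
    rw [← mul_assoc, this, mul_assoc, gen_mul_self, mul_one]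
  · have hw : w * E.gen s * E.gen s = w := by rw [mul_assoc, gen_mul_self, mul_one]
    have := E.rootReflection_mul_of_eq_smul (E.eq_smul_of_val_mul_gen_neg ρ.2 h' (s := s)
      (by rw [hw]; exact E.val_neg_of_not_pos ρ.2 h))
    rw [hw] at this
    have hr := congrArg (E.rootReflection ρ * ·) this
    simp only [← mul_assoc, rootReflection_mul_self, one_mul] at hr
    rw [hr]
  · rw [← mul_assoc]
    refine (E.adj_deleteEdges_wall ?_ ?_).reachable
    · rw [val_rootReflection_mul]
      linarith [E.val_neg_of_not_pos ρ.2 h]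
    · rw [mul_assoc, val_rootReflection_mul]
      linarith [E.val_neg_of_not_pos ρ.2 h']

/-- The half-space of `ρ` consists of the chambers at which `ρ` is positive. -/
theorem mem_halfSpace_iff (ρ : E.roots) (w : E.weylGroup) :
    w ∈ E.halfSpace ρ ↔ 0 < E.val w ρ := by
  have hbase : ∀ (u : E.weylGroup) (s : E.simple), (ρ : V) = u • (s : V) → 0 < E.val u ρ := by
    intro u s h
    rw [h, val_smul, inv_mul_cancel, val_apply, inv_one, one_smul]
    exact E.height_simple_pos s.2
  constructor
  · rintro ⟨u, ⟨π, hπ, hu⟩, ⟨p⟩⟩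
    have hu' := hbase u ⟨π, hπ⟩ hu.symm
    clear hu
    induction p with
    | nil => exact hu'
    | cons hadj p ih =>
      refine ih ?_
      rw [SimpleGraph.deleteEdges_adj] at hadj
      obtain ⟨hadj, hwall⟩ := hadj
      obtain ⟨s, rfl⟩ := E.exists_eq_mul_gen_of_adj hadj
      by_contra hneg
      have := E.rootReflection_mul_of_eq_smul
        (E.eq_smul_of_val_mul_gen_neg ρ.2 hu' (E.val_neg_of_not_pos ρ.2 hneg))
      exact hwall ⟨hadj, _, by rw [this]⟩
  · intro hw
    obtain ⟨u, s, hus⟩ := E.exists_smul_simple ρ.2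
    refine ⟨u, ⟨s, s.2, hus.symm⟩, ?_⟩
    obtain ⟨l, hl⟩ := E.exists_word (u⁻¹ * w)
    obtain rfl : w = u * (l.map E.gen).prod := by rw [hl, mul_inv_cancel_left]
    have key : ((SimpleGraph.mulCayley E.simpleReflections).deleteEdges (E.wall ρ)).Reachable
        u (E.fold ρ (u * (l.map E.gen).prod)) := by
      clear hl hw
      induction l using List.reverseRecOn with
      | nil => simp [fold, hbase u s hus]
      | append_singleton l t ih =>
        rw [List.map_append, List.prod_append, ← mul_assoc, List.map_singleton,
          List.prod_singleton]
        exact ih.trans (E.reachable_fold_mul_gen ρ _ t)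
    rwa [fold, if_pos hw] at key

theorem halfSpace_nonempty (ρ : E.roots) : (E.halfSpace ρ).Nonempty := by
  obtain ⟨u, π, hπ, hu⟩ := ρ.2
  exact ⟨u, u, ⟨π, hπ, hu⟩, .refl _⟩

theorem halfSpace_subset_iff {α β : E.roots} :
    E.halfSpace α ⊆ E.halfSpace β ↔ ∀ w, 0 < E.val w α → 0 < E.val w β := by
  simp [Set.subset_def, mem_halfSpace_iff]

theorem StrictlyContained.exists_val {α β : E.roots} (h : E.StrictlyContained α β) :
    ∃ w, E.val w α < 0 ∧ 0 < E.val w β := by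
  obtain ⟨w, hw, hw'⟩ := Set.exists_of_ssubset h
  rw [mem_halfSpace_iff] at hw hw'
  exact ⟨w, E.val_neg_of_not_pos α.2 hw', hw⟩

/-- A chamber `u` adjacent to the wall of `α` and its mirror image lie on different sides of no other
wall, so the half-space determines the root. -/
theorem eq_of_halfSpace_eq {α β : E.roots} (h : E.halfSpace α = E.halfSpace β) : α = β := by
  obtain ⟨u, s, hus⟩ := E.exists_smul_simple α.2
  have hiff : ∀ w, 0 < E.val w α ↔ 0 < E.val w β := fun w => by
    rw [← mem_halfSpace_iff, h, mem_halfSpace_iff]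
  have h1 : 0 < E.val u α := by
    rw [hus, val_smul, inv_mul_cancel, val_apply, inv_one, one_smul]
    exact E.height_simple_pos s.2
  have h2 : ¬ 0 < E.val (u * E.gen s) α := by
    rw [← E.rootReflection_mul_of_eq_smul hus, val_rootReflection_mul]
    linarith
  refine Subtype.ext (hus.trans (E.eq_smul_of_val_mul_gen_neg β.2 ((hiff u).1 h1) ?_).symm)
  exact E.val_neg_of_not_pos β.2 (fun hp => h2 ((hiff _).2 hp))

/-! ### Opposite roots and flips -/

/-- The root `-ρ`, whose half-space is complementary to that of `ρ`. -/
def negRoot (ρ : E.roots) : E.roots := ⟨-(ρ : V), E.neg_mem_roots ρ.2⟩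

/-- The root `-r_α β`. If the half-space of `β` lies in that of `α`, then the half-space of
`-r_α β` contains that of `α`, and conversely. -/
def flip (α β : E.roots) : E.roots :=
  E.negRoot ⟨E.rootReflection α • (β : V), E.smul_mem_roots _ β.2⟩

theorem coe_negRoot (ρ : E.roots) : (E.negRoot ρ : V) = -(ρ : V) := rfl

theorem coe_flip (α β : E.roots) :
    (E.flip α β : V) = (2 * E.form (α : V) β) • (α : V) - (β : V) := by
  change -(E.rootReflection α • (β : V)) = _
  rw [rootReflection_smul, E.form_symm β α, neg_sub]

theorem flip_self (α : E.roots) : E.flip α α = α := by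
  refine Subtype.ext ?_
  rw [coe_flip, E.form_root_self α.2]
  module

theorem flip_flip (α β : E.roots) : E.flip α (E.flip α β) = β := by
  refine Subtype.ext ?_
  rw [coe_flip, coe_flip, map_sub, map_smul, smul_eq_mul, E.form_root_self α.2]
  module

theorem form_flip (α β : E.roots) (v : V) :
    E.form v (E.flip α β) = 2 * E.form (α : V) β * E.form v α - E.form v β := by
  rw [coe_flip, map_sub, map_smul, smul_eq_mul]

theorem val_mul_rootReflection (w : E.weylGroup) (α β : E.roots) :
    E.val (E.rootReflection α * w) β = E.val w β - 2 * E.form (α : V) β * E.val w α := by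
  have := E.val_smul w (E.rootReflection α) β
  rw [rootReflection_inv] at this
  rw [← this, rootReflection_smul, map_sub, map_smul, smul_eq_mul, E.form_symm β α]

theorem halfSpace_negRoot (ρ : E.roots) : E.halfSpace (E.negRoot ρ) = (E.halfSpace ρ)ᶜ := by
  ext w
  rw [Set.mem_compl_iff, mem_halfSpace_iff, mem_halfSpace_iff, coe_negRoot, map_neg]
  refine ⟨fun h => by linarith, fun h => ?_⟩
  linarith [E.val_neg_of_not_pos ρ.2 h]

theorem halfSpace_flip (α β : E.roots) :
    E.halfSpace (E.flip α β) = {w | E.rootReflection α * w ∉ E.halfSpace β} := by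
  ext w
  rw [flip, halfSpace_negRoot, Set.mem_compl_iff, mem_halfSpace_iff, val_smul,
    rootReflection_inv, Set.mem_ofPred_eq, mem_halfSpace_iff]

theorem StrictlyContained.negRoot {α β : E.roots} (h : E.StrictlyContained α β) :
    E.StrictlyContained (E.negRoot β) (E.negRoot α) := by
  unfold StrictlyContained
  rw [halfSpace_negRoot, halfSpace_negRoot]
  exact compl_lt_compl_iff_lt.2 h

theorem StrictlyContained.flip {α β : E.roots} (h : E.StrictlyContained α β) (δ : E.roots) :
    E.StrictlyContained (E.flip δ β) (E.flip δ α) := by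
  refine (Set.ssubset_iff_of_subset ?_).2 ?_
  · rw [halfSpace_flip, halfSpace_flip]
    exact fun w hw hw' => hw (h.1 hw')
  · obtain ⟨w, hw, hw'⟩ := Set.exists_of_ssubset h
    refine ⟨E.rootReflection δ * w, ?_, ?_⟩ <;>
    rw [halfSpace_flip, Set.mem_ofPred_eq, ← mul_assoc, rootReflection_mul_self, one_mul]
    · exact hw'
    · exact not_not.2 hw

/-! ### Products of nested roots -/

/-- For `t = 2 cos θ` this says that a rotation by a nonzero angle `θ` has no orbit in an open
half-plane: for `t < 2` the sequence is concave, by an amount bounded away from `0`. -/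
theorem two_le_of_recurrence {t : ℝ} {a : ℕ → ℝ} (hpos : ∀ k, 0 < a k)
    (h : ∀ k, a (k + 2) = t * a (k + 1) - a k) : 2 ≤ t := by
  by_contra! ht
  have hd : ∀ k, a (k + 2) - a (k + 1) = (a (k + 1) - a k) - (2 - t) * a (k + 1) := fun k => by
    rw [h]; ring
  have hmono : ∀ k, a k ≤ a (k + 1) := by
    intro k
    by_contra! hk
    have hstep : ∀ n, a (k + n + 1) - a (k + n) ≤ a (k + 1) - a k ∧
        a (k + n) ≤ a k - n * (a k - a (k + 1)) := by
      intro n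
      induction n with
      | zero => simp
      | succ n ih =>
        have h1 := hd (k + n)
        have h2 := mul_pos (sub_pos.2 ht) (hpos (k + n + 1))
        refine ⟨by rw [← add_assoc]; linarith [ih.1], ?_⟩
        rw [← add_assoc]
        push_cast
        linarith [ih.1, ih.2]
    obtain ⟨n, hn⟩ := exists_nat_gt (a k / (a k - a (k + 1)))
    rw [div_lt_iff₀ (by linarith)] at hn
    linarith [(hstep n).2, hpos (k + n)]
  have hge : ∀ k, a 0 ≤ a k := fun k => monotone_nat_of_le_succ hmono (Nat.zero_le k)
  have hstep : ∀ n : ℕ, a (n + 1) - a n ≤ a 1 - a 0 - n * ((2 - t) * a 0) := by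
    intro n
    induction n with
    | zero => simp
    | succ n ih =>
      have h1 := hd n
      have h2 := mul_le_mul_of_nonneg_left (hge (n + 1)) (sub_pos.2 ht).le
      push_cast
      linarith
  have hp := mul_pos (sub_pos.2 ht) (hpos 0)
  obtain ⟨n, hn⟩ := exists_nat_gt ((a 1 - a 0) / ((2 - t) * a 0))
  rw [div_lt_iff₀ hp] at hn
  linarith [hstep n, hmono n]

/-- If the product of `α` and `β` were less than `1`, the rotation `r_α r_β` would move a chamber of
the half-space of `α` out of the region which nestedness allows. -/
theorem one_le_form_of_subset {α β : E.roots} (h : E.halfSpace α ⊆ E.halfSpace β) :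
    1 ≤ E.form (α : V) β := by
  rw [halfSpace_subset_iff] at h
  obtain ⟨w₀, hw₀⟩ := E.halfSpace_nonempty α
  rw [mem_halfSpace_iff] at hw₀
  set c := E.form (α : V) β with hc
  have hneg : ∀ w, 0 < E.val w α → E.val w α < 2 * c * E.val w β := by
    intro w hw
    have h1 : ¬ 0 < E.val (E.rootReflection β * w) α := fun h' => by
      have := h _ h'
      rw [val_rootReflection_mul] at this
      linarith [h w hw]
    have h2 := E.val_neg_of_not_pos α.2 h1
    rw [val_mul_rootReflection, E.form_symm β α] at h2
    linarith
  -- By `hneg` the chambers `(r_α r_β)^k w₀` all stay in the half-space of `α`.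
  let w : ℕ → E.weylGroup := fun k => (E.rootReflection α * E.rootReflection β) ^ k * w₀
  have hw : ∀ k, w (k + 1) = E.rootReflection α * (E.rootReflection β * w k) := fun k => by
    simp only [w, pow_succ', mul_assoc]
  have hα : ∀ k, E.val (w (k + 1)) α = 2 * c * E.val (w k) β - E.val (w k) α := fun k => by
    rw [hw, val_rootReflection_mul, val_mul_rootReflection, E.form_symm β α]
    ring
  have hβ : ∀ k, E.val (w (k + 1)) β = 2 * c * E.val (w (k + 1)) α - E.val (w k) β := fun k => by
    rw [hα, hw, val_mul_rootReflection, val_rootReflection_mul, val_mul_rootReflection,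
      E.form_symm β α, ← hc]
    ring
  have hpos : ∀ k, 0 < E.val (w k) α := fun k => by
    induction k with
    | zero => simpa [w] using hw₀
    | succ k ih => rw [hα]; linarith [hneg _ ih]
  have h2 := two_le_of_recurrence (t := 4 * c ^ 2 - 2) hpos fun k => by
    have h1 := hα k
    rw [hα (k + 1), hβ k]
    linear_combination h1
  have hc0 : 0 < c := by
    have h3 := hneg w₀ hw₀
    by_contra! hc0
    nlinarith [h w₀ hw₀]
  nlinarith

/-- The roots obtained from `ρ 0` and `ρ 1` by successive reflections. -/
def flipSeq (ρ₀ ρ₁ : E.roots) : ℕ → E.roots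
  | 0 => ρ₀
  | 1 => ρ₁
  | k + 2 => E.flip (flipSeq ρ₀ ρ₁ (k + 1)) (flipSeq ρ₀ ρ₁ k)

theorem form_flipSeq (ρ₀ ρ₁ : E.roots) (k : ℕ) :
    E.form (E.flipSeq ρ₀ ρ₁ (k + 1) : V) (E.flipSeq ρ₀ ρ₁ k) = E.form (ρ₁ : V) ρ₀ := by
  induction k with
  | zero => rfl
  | succ k ih =>
    rw [E.form_symm, flipSeq, form_flip, E.form_root_self (E.flipSeq ρ₀ ρ₁ (k + 1)).2, ih]
    ring

theorem flipSeq_growth {ρ₀ ρ₁ : E.roots} (hc : 1 ≤ E.form (ρ₁ : V) ρ₀) (φ : Module.Dual ℝ V)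
    (h1 : 0 < φ ρ₁) (h2 : φ ρ₀ < φ ρ₁) (k : ℕ) :
    0 < φ (E.flipSeq ρ₀ ρ₁ (k + 1)) ∧ φ (E.flipSeq ρ₀ ρ₁ k) < φ (E.flipSeq ρ₀ ρ₁ (k + 1)) := by
  induction k with
  | zero => exact ⟨h1, h2⟩
  | succ k ih =>
    have h3 : φ (E.flipSeq ρ₀ ρ₁ (k + 1 + 1)) = 2 * E.form (ρ₁ : V) ρ₀ *
        φ (E.flipSeq ρ₀ ρ₁ (k + 1)) - φ (E.flipSeq ρ₀ ρ₁ k) := by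
      rw [flipSeq, coe_flip, map_sub, map_smul, smul_eq_mul, form_flipSeq]
    have h4 := mul_nonneg (sub_nonneg.2 hc) ih.1.le
    constructor <;> nlinarith [ih.1, ih.2]

/-- No two chambers lie on opposite sides of infinitely many of the walls obtained from `ρ₀` and
`ρ₁` by successive reflections. -/
theorem not_separated_of_growth {ρ₀ ρ₁ : E.roots} (hc : 1 ≤ E.form (ρ₁ : V) ρ₀)
    {w w' : E.weylGroup} (h1 : 0 < E.val w ρ₁) (h2 : E.val w ρ₀ < E.val w ρ₁)
    (h1' : E.val w' ρ₁ < 0) (h2' : E.val w' ρ₁ < E.val w' ρ₀) : False := by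
  have hg := E.flipSeq_growth hc (E.val w) h1 h2
  have hg' := E.flipSeq_growth hc (-E.val w') (by simpa using h1') (by simpa using h2')
  have hmono : StrictMono fun k => E.val w (E.flipSeq ρ₀ ρ₁ k) := strictMono_nat_of_lt_succ
    fun k => (hg k).2
  refine Set.infinite_of_injective_forall_mem (f := fun k => (E.flipSeq ρ₀ ρ₁ (k + 1) : V))
    (fun i j hij => ?_) (fun k => ?_) (E.finite_separating w w')
  · exact Nat.succ_injective (hmono.injective (congrArg (E.val w) hij))
  · have := (hg' k).1
    rw [LinearMap.neg_apply] at this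
    exact ⟨(E.flipSeq ρ₀ ρ₁ (k + 1)).2, (hg k).1, by linarith⟩

theorem subset_or_subset_of_one_le_form {α β : E.roots} (h : 1 ≤ E.form (α : V) β) :
    E.halfSpace α ⊆ E.halfSpace β ∨ E.halfSpace β ⊆ E.halfSpace α := by
  by_contra! hn
  obtain ⟨w, hw, hw'⟩ := Set.not_subset.1 hn.1
  obtain ⟨u, hu, hu'⟩ := Set.not_subset.1 hn.2
  rw [mem_halfSpace_iff] at hw hw' hu hu'
  have hw'' := E.val_neg_of_not_pos β.2 hw'
  have hu'' := E.val_neg_of_not_pos α.2 hu'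
  exact E.not_separated_of_growth h hw (hw''.trans hw) hu'' (hu''.trans hu)

theorem trichotomy_of_one_le_form {α β : E.roots} (h : 1 ≤ E.form (α : V) β) :
    E.StrictlyContained α β ∨ α = β ∨ E.StrictlyContained β α := by
  rcases E.subset_or_subset_of_one_le_form h with h | h
  · rcases h.eq_or_ssubset with h | h
    · exact .inr (.inl (E.eq_of_halfSpace_eq h))
    · exact .inl h
  · rcases h.eq_or_ssubset with h | h
    · exact .inr (.inl (E.eq_of_halfSpace_eq h.symm))
    · exact .inr (.inr h)

theorem StrictlyContained.one_le_form {α β : E.roots} (h : E.StrictlyContained α β) :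
    1 ≤ E.form (α : V) β :=
  E.one_le_form_of_subset h.1

/-- For nested roots not only the signs but also the values at all chambers are ordered: otherwise
repeated reflection, towards one side or the other, would give infinitely many walls between two
chambers. -/
theorem StrictlyContained.val_le {α β : E.roots} (h : E.StrictlyContained α β)
    (w : E.weylGroup) : E.val w α ≤ E.val w β := by
  by_contra! hlt
  have hc := h.one_le_form
  have hc' : 1 ≤ E.form (β : V) α := by rwa [E.form_symm]
  obtain ⟨u, hu, hu'⟩ := h.exists_val
  by_cases hp : 0 < E.val w β
  · exact E.not_separated_of_growth hc (hp.trans hlt) hlt hu (hu.trans hu')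
  · exact E.not_separated_of_growth hc' hu' (hu.trans hu') (E.val_neg_of_not_pos β.2 hp) hlt

/-- If `γ - β` had negative product with `α`, then applying `r_α r_β` repeatedly to it would
give vectors whose values at a chamber between the walls of `α` and `β` tend to `-∞`, whereas all
values of `γ - β` are non-negative. -/
theorem StrictlyContained.form_le_form_right {α β γ : E.roots} (hαβ : E.StrictlyContained α β)
    (hβγ : E.StrictlyContained β γ) : E.form (α : V) β ≤ E.form (α : V) γ := by
  by_contra! hlt
  have hp := hαβ.one_le_form
  have hc := hβγ.one_le_form
  obtain ⟨u, hu, hu'⟩ := hαβ.exists_val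
  set p := E.form (α : V) β with hpdef
  set v : V := (γ : V) - β with hv
  set A := -E.form (α : V) v with hA
  have hA0 : 0 < A := by rw [hA, hv, map_sub]; linarith
  have hnonneg : ∀ g : E.weylGroup, 0 ≤ E.val u (g • v) := fun g => by
    rw [val_smul, hv, map_sub]
    exact sub_nonneg.2 (hβγ.val_le E _)
  -- The products of the successive images of `γ - β` with `β` and `α` grow in absolute value; the
  -- first two conditions say so and are preserved by `r_α r_β`.
  have key : ∀ n : ℕ, ∃ g : E.weylGroup, 0 ≤ E.form (β : V) (g • v) ∧
      A ≤ 2 * p * E.form (β : V) (g • v) - E.form (α : V) (g • v) - E.form (β : V) (g • v) ∧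
      E.val u (g • v) ≤ E.val u v - n * (2 * A * -E.val u α) := by
    intro n
    induction n with
    | zero =>
      have h0 : 0 ≤ E.form (β : V) v := by
        rw [hv, map_sub, E.form_root_self β.2]
        linarith
      refine ⟨1, ?_⟩
      rw [one_smul]
      refine ⟨h0, ?_, by simp⟩
      nlinarith [mul_nonneg (sub_nonneg.2 hp) h0]
    | succ n ih =>
      obtain ⟨g, h0, h1, h2⟩ := ih
      refine ⟨E.rootReflection α * (E.rootReflection β * g), ?_⟩
      rw [mul_smul, mul_smul]
      generalize g • v = z at h0 h1 h2
      set s := E.form (β : V) z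
      set r := 2 * p * s - E.form (α : V) z with hr
      have hz : E.rootReflection α • E.rootReflection β • z =
          z - (2 * s) • (β : V) + (2 * r) • (α : V) := by
        rw [rootReflection_smul, rootReflection_smul, E.form_symm z β, map_sub, map_smul,
          LinearMap.sub_apply, LinearMap.smul_apply, smul_eq_mul, E.form_symm β α, E.form_symm z α,
          hr]
        module
      have hβ : E.form (β : V) (E.rootReflection α • E.rootReflection β • z) = 2 * p * r - s := by
        rw [hz]
        simp only [map_add, map_sub, map_smul, smul_eq_mul, E.form_root_self β.2]
        rw [E.form_symm β α]
        ring
      have hα : E.form (α : V) (E.rootReflection α • E.rootReflection β • z) = r := by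
        rw [hz]
        simp only [map_add, map_sub, map_smul, smul_eq_mul, E.form_root_self α.2]
        rw [hr]
        ring
      have hrs : s + A ≤ r := by linarith
      have hr0 : 0 ≤ r := by linarith
      have hpr : r ≤ p * r := by nlinarith
      rw [hα, hβ]
      refine ⟨by linarith, ?_, ?_⟩
      · have : 0 ≤ (p - 1) * (2 * p * r - s) := mul_nonneg (by linarith) (by linarith)
        linarith
      · rw [hz]
        simp only [map_add, map_sub, map_smul, smul_eq_mul]
        push_cast
        have h3 := mul_nonneg h0 hu'.le
        have h4 : (s + A) * -E.val u α ≤ r * -E.val u α :=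
          mul_le_mul_of_nonneg_right hrs (by linarith)
        have h5 := mul_nonneg h0 (neg_pos.2 hu).le
        linarith
  have hpos : 0 < 2 * A * -E.val u α := by
    have := neg_pos.2 hu
    positivity
  obtain ⟨n, hn⟩ := exists_nat_gt (E.val u v / (2 * A * -E.val u α))
  rw [div_lt_iff₀ hpos] at hn
  obtain ⟨g, -, -, hg⟩ := key n
  linarith [hnonneg g]

theorem StrictlyContained.form_le_form_left {α β γ : E.roots} (hαβ : E.StrictlyContained α β)
    (hβγ : E.StrictlyContained β γ) : E.form (β : V) γ ≤ E.form (α : V) γ := by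
  have := StrictlyContained.form_le_form_right E (hβγ.negRoot E) (hαβ.negRoot E)
  simpa [coe_negRoot, E.form_symm (γ : V)] using this

/-! ### Chains of roots -/

/-- There is a chain of roots `α ⊊ ⋯ ⊊ β` with `k` steps. -/
inductive HasChain : ℕ → E.roots → E.roots → Prop
  | refl (α : E.roots) : HasChain 0 α α
  | step {k : ℕ} {α β γ : E.roots} : HasChain k α β → E.StrictlyContained β γ →
      HasChain (k + 1) α γ

variable {E}

theorem HasChain.trans {k l : ℕ} {α β γ : E.roots} (h : E.HasChain k α β)
    (h' : E.HasChain l β γ) : E.HasChain (k + l) α γ := by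
  induction h' with
  | refl => exact h
  | step _ hs ih => exact (ih h).step hs

theorem HasChain.single {α β : E.roots} (h : E.StrictlyContained α β) : E.HasChain 1 α β :=
  (HasChain.refl α).step h

theorem HasChain.flip {k : ℕ} {α β : E.roots} (h : E.HasChain k α β) (δ : E.roots) :
    E.HasChain k (E.flip δ β) (E.flip δ α) := by
  induction h with
  | refl => exact .refl _
  | @step k _ _ _ _ hs ih =>
    rw [add_comm]
    exact (HasChain.single (StrictlyContained.flip E hs δ)).trans ih

theorem HasChain.exists_isRootChain {k : ℕ} {α β : E.roots} (h : E.HasChain k α β) :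
    ∃ γ : Fin (k + 1) → E.roots, E.IsRootChain k γ ∧ γ 0 = α ∧ γ (Fin.last k) = β := by
  induction h with
  | refl α => exact ⟨fun _ => α, fun i => i.elim0, rfl, rfl⟩
  | @step k α β δ _ hs ih =>
    obtain ⟨γ, hγ, h0, hl⟩ := ih
    refine ⟨Fin.snoc γ δ, fun i => ?_, ?_, Fin.snoc_last _ _⟩
    · induction i using Fin.lastCases with
      | last => rw [Fin.snoc_castSucc, hl, Fin.succ_last, Fin.snoc_last]; exact hs
      | cast i => rw [Fin.snoc_castSucc, Fin.succ_castSucc, Fin.snoc_castSucc]; exact hγ i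
    · rw [← Fin.castSucc_zero, Fin.snoc_castSucc, h0]

variable (E) in
/-- A maximally convex chain `a 0 ⊊ ⋯ ⊊ a n`, as the initial part of a sequence of roots. -/
structure IsMaxChain (n : ℕ) (a : ℕ → E.roots) : Prop where
  strict : ∀ i < n, E.StrictlyContained (a i) (a (i + 1))
  le_of_hasChain : ∀ k, E.HasChain k (a 0) (a n) → k ≤ n

theorem IsMaximallyConvex.isMaxChain {n : ℕ} {α : Fin (n + 1) → E.roots}
    (h : E.IsMaximallyConvex n α) :
    E.IsMaxChain n fun i => α ⟨min i n, by omega⟩ := by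
  refine ⟨fun i hi => ?_, fun k hk => ?_⟩
  · have := h.1 ⟨i, hi⟩
    convert this using 2
    · exact Fin.ext (min_eq_left hi.le)
    · exact Fin.ext (min_eq_left hi)
  · obtain ⟨γ, hγ, h0, hl⟩ := hk.exists_isRootChain
    refine h.2 k γ hγ (h0.trans ?_) (hl.trans ?_)
    · exact congrArg α (Fin.ext (Nat.zero_min n))
    · exact congrArg α (Fin.ext (min_self n))

namespace IsMaxChain

variable {n : ℕ} {a : ℕ → E.roots}

theorem hasChain (h : E.IsMaxChain n a) {i k : ℕ} (hk : i + k ≤ n) :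
    E.HasChain k (a i) (a (i + k)) := by
  induction k with
  | zero => exact .refl _
  | succ k ih => exact (ih (by omega)).step (h.strict _ (by omega))

theorem strictlyContained (h : E.IsMaxChain n a) {i l : ℕ} (hil : i < l) (hl : l ≤ n) :
    E.StrictlyContained (a i) (a l) := by
  induction l, hil using Nat.le_induction with
  | base => exact h.strict i hl
  | succ l hil ih => exact LE.le.trans_ssubset (ih (by omega)).1 (h.strict l hl)

theorem le_of_hasChain_between (h : E.IsMaxChain n a) {i l k : ℕ} (hl : i + l ≤ n)
    (hk : E.HasChain k (a i) (a (i + l))) : k ≤ l := by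
  have h1 := h.hasChain (i := 0) (k := i) (by omega)
  have h2 := h.hasChain (i := i + l) (k := n - (i + l)) (by omega)
  rw [zero_add] at h1
  rw [Nat.add_sub_cancel' hl] at h2
  have := h.le_of_hasChain _ ((h1.trans hk).trans h2)
  omega

theorem not_between (h : E.IsMaxChain n a) {i : ℕ} (hi : i + 1 ≤ n) {δ : E.roots}
    (h1 : E.StrictlyContained (a i) δ) (h2 : E.StrictlyContained δ (a (i + 1))) : False := by
  have := h.le_of_hasChain_between hi ((HasChain.single h1).step h2)
  omega

theorem one_le_form (h : E.IsMaxChain n a) {i l : ℕ} (hil : i ≤ l) (hl : l ≤ n) :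
    1 ≤ E.form (a i : V) (a l) := by
  rcases hil.eq_or_lt with rfl | hil
  · exact (E.form_root_self (a i).2).ge
  · exact StrictlyContained.one_le_form E (h.strictlyContained hil hl)

theorem form_mono_right (h : E.IsMaxChain n a) {i l l' : ℕ} (hil : i ≤ l) (hl : l ≤ l')
    (hl' : l' ≤ n) : E.form (a i : V) (a l) ≤ E.form (a i : V) (a l') := by
  rcases hil.eq_or_lt with rfl | hil
  · rw [E.form_root_self (a i).2]
    exact h.one_le_form hl hl'
  rcases hl.eq_or_lt with rfl | hl
  · exact le_rfl
  exact StrictlyContained.form_le_form_right E (h.strictlyContained hil (by omega))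
    (h.strictlyContained hl hl')

theorem form_anti_left (h : E.IsMaxChain n a) {i i' l : ℕ} (hi : i ≤ i') (hil : i' ≤ l)
    (hl : l ≤ n) : E.form (a i' : V) (a l) ≤ E.form (a i : V) (a l) := by
  rcases hil.eq_or_lt with rfl | hil
  · rw [E.form_root_self (a i').2]
    exact h.one_le_form hi hl
  rcases hi.eq_or_lt with rfl | hi
  · exact le_rfl
  exact StrictlyContained.form_le_form_left E (h.strictlyContained hi (by omega))
    (h.strictlyContained hil hl)

/-- If three consecutive members of a maximally convex chain have pairwise product `1`, then the
outer two are interchanged by the flip at the middle one: otherwise one of the two flipped roots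
could be inserted in the chain. -/
theorem flip_eq (h : E.IsMaxChain n a) {i : ℕ} (hi : i + 2 ≤ n)
    (h1 : E.form (a i : V) (a (i + 2)) = 1) : E.flip (a (i + 1)) (a i) = a (i + 2) := by
  have h2 : E.form (a i : V) (a (i + 1)) = 1 :=
    le_antisymm ((h.form_mono_right (by omega) (by omega) hi).trans h1.le)
      (h.one_le_form (by omega) (by omega))
  have h3 : E.form (a (i + 1) : V) (a (i + 2)) = 1 :=
    le_antisymm ((h.form_anti_left (by omega) (by omega) hi).trans h1.le)
      (h.one_le_form (by omega) (by omega))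
  have h4 : 1 ≤ E.form (a (i + 2) : V) (E.flip (a (i + 1)) (a i)) := by
    rw [form_flip, E.form_symm (a (i + 1)), h2, E.form_symm (a (i + 2)), h3,
      E.form_symm (a (i + 2)), h1]
    norm_num
  rcases E.trichotomy_of_one_le_form h4 with h5 | h5 | h5
  · have h6 := StrictlyContained.flip E h5 (a (i + 1))
    have h7 := StrictlyContained.flip E (h.strict (i + 1) (by omega)) (a (i + 1))
    rw [flip_flip] at h6
    rw [flip_self] at h7
    exact (h.not_between (by omega) h6 h7).elim
  · exact h5.symm
  · have h7 := StrictlyContained.flip E (h.strict i (by omega)) (a (i + 1))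
    rw [flip_self] at h7
    exact (h.not_between (i := i + 1) (by omega) h7 h5).elim

/-- Along the part of the chain where `(a 0, a i) = 1`, the roots form an arithmetic progression, so
the products with a fixed vector do too. -/
theorem form_eq_of_form_eq_one (h : E.IsMaxChain n a) {m : ℕ} (hm : m + 1 ≤ n)
    (h1 : E.form (a 0 : V) (a (m + 1)) = 1) (v : V) {i : ℕ} (hi : i ≤ m) :
    E.form v (a i) = E.form v (a 0) - i * (E.form v (a 0) - E.form v (a 1)) ∧
    E.form v (a (i + 1)) =
      E.form v (a 0) - (i + 1 : ℕ) * (E.form v (a 0) - E.form v (a 1)) := by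
  induction i with
  | zero => simp
  | succ i ih =>
    obtain ⟨h2, h3⟩ := ih (by omega)
    refine ⟨h3, ?_⟩
    have h4 : ∀ {k l}, k ≤ l → l ≤ m + 1 → E.form (a k : V) (a l) = 1 := fun hk hl =>
      le_antisymm (((h.form_anti_left (Nat.zero_le _) hk (by omega)).trans
        (h.form_mono_right (Nat.zero_le _) hl hm)).trans h1.le) (h.one_le_form hk (by omega))
    have h5 := E.form_flip (a (i + 1)) (a i) v
    rw [h.flip_eq (by omega) (h4 (by omega) (by omega)), E.form_symm (a (i + 1)),
      h4 (by omega) (by omega)] at h5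
    rw [h5, h2, h3]
    push_cast
    ring

end IsMaxChain

/-! ### The two estimates -/

theorem kappa_nonneg : 0 ≤ E.kappa := by
  refine Real.sSup_nonneg ?_
  rintro t ⟨α, β, rfl, -⟩
  exact abs_nonneg _

theorem form_le_kappa {α β : E.roots} (h : E.form (α : V) β < 1) :
    E.form (α : V) β ≤ E.kappa := by
  rcases le_or_gt (E.form (α : V) β) (-1) with h' | h'
  · linarith [kappa_nonneg (E := E)]
  · refine (le_abs_self _).trans (le_csSup ⟨1, ?_⟩ ⟨α, β, rfl, abs_lt.2 ⟨h', h⟩⟩)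
    rintro t ⟨_, _, -, ht⟩
    exact ht.le

namespace IsMaxChain

variable {n : ℕ} {a : ℕ → E.roots}

/-- The flip of `a m` at `a (m + 1)` cannot be nested with `a (m + 2)`, so that its product with
`a (m + 2)` is at most `κ`. This bounds the common difference of the arithmetic progression formed by
the products of `a (m + 2)` with the earlier roots. -/
theorem le_form_of_form_ne_one (h : E.IsMaxChain n a) {m : ℕ} (hm : m + 2 ≤ n)
    (h1 : E.form (a 0 : V) (a (m + 1)) = 1) (h2 : E.form (a 0 : V) (a (m + 2)) ≠ 1) :
    (m + 2 : ℝ) * (1 - E.kappa) ≤ E.form (a 0 : V) (a (m + 2)) := by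
  have h3 : 1 < E.form (a 0 : V) (a (m + 2)) :=
    lt_of_le_of_ne (h.one_le_form (by omega) hm) h2.symm
  have h4 : E.form (a 0 : V) (a m) = 1 :=
    le_antisymm ((h.form_mono_right (Nat.zero_le _) m.le_succ (by omega)).trans h1.le)
      (h.one_le_form (by omega) (by omega))
  have h5 : E.form (a (m + 1) : V) (a m) = 1 := by
    rw [E.form_symm]
    exact le_antisymm ((h.form_anti_left (Nat.zero_le _) (by omega) (by omega)).trans h1.le)
      (h.one_le_form (by omega) (by omega))
  have h6 : E.form (a 0 : V) (E.flip (a (m + 1)) (a m)) = 1 := by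
    rw [form_flip, h5, h1, h4]
    norm_num
  have h7 : E.form (a (m + 2) : V) (E.flip (a (m + 1)) (a m)) < 1 := by
    by_contra! hle
    rcases E.trichotomy_of_one_le_form hle with h8 | h8 | h8
    · have := StrictlyContained.form_le_form_right E
        (h.strictlyContained (i := 0) (by omega) hm) h8
      rw [h6] at this
      linarith
    · rw [← h8] at h6
      exact h2 h6
    · have h9 := StrictlyContained.flip E (h.strict m (by omega)) (a (m + 1))
      rw [flip_self] at h9
      exact h.not_between (i := m + 1) hm h9 h8
  have h8 := form_le_kappa h7
  rw [form_flip, h5] at h8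
  obtain ⟨h9, h10⟩ := h.form_eq_of_form_eq_one (by omega) h1 (a (m + 2)) le_rfl
  have h11 := h.one_le_form (i := m + 1) (l := m + 2) (by omega) hm
  rw [E.form_symm] at h11 ⊢
  push_cast at h10
  set d := E.form (a (m + 2) : V) (a 0) - E.form (a (m + 2) : V) (a 1)
  have hd : 1 - E.kappa ≤ d := by linarith
  have hm0 : (0 : ℝ) ≤ m + 1 := by positivity
  nlinarith [mul_le_mul_of_nonneg_left hd hm0, kappa_nonneg (E := E)]

/-- The excess over `1` of the product with `a 0` at least doubles with the index. The root `a (2 k)`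
is compared with the flip of `a 0` at `a k`; if it were strictly inside, the flip of the chain from
`a k` to the flipped root would be too long a chain from `a 0` to `a k`. -/
theorem two_mul_form_sub_one_le (h : E.IsMaxChain n a) {k : ℕ} (hk : 2 * k ≤ n) :
    2 * (E.form (a 0 : V) (a k) - 1) ≤ E.form (a 0 : V) (a (2 * k)) - 1 := by
  rcases Nat.eq_zero_or_pos k with rfl | hk0
  · simp [E.form_root_self (a 0).2]
  have hc := h.one_le_form (i := 0) (l := k) (by omega) (by omega)
  have hck := h.one_le_form (i := k) (l := 2 * k) (by omega) hk
  have hflip0 := E.form_flip (a k) (a 0) (a 0)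
  have hflip := E.form_flip (a k) (a 0) (a (2 * k))
  rw [E.form_symm (a k), E.form_root_self (a 0).2] at hflip0
  rw [E.form_symm (a k), E.form_symm (a (2 * k)) (a k), E.form_symm (a (2 * k)) (a 0)] at hflip
  have hsq : 0 ≤ (E.form (a 0 : V) (a k) - 1) * E.form (a 0 : V) (a k) :=
    mul_nonneg (by linarith) (by linarith)
  by_cases hone : 1 ≤ E.form (a (2 * k) : V) (E.flip (a k) (a 0))
  · rcases E.trichotomy_of_one_le_form hone with h1 | h1 | h1
    · have h2 := h.hasChain (i := k) (k := k) (by omega)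
      rw [← two_mul] at h2
      have h3 := (h2.step h1).flip (a k)
      rw [flip_flip, flip_self] at h3
      have h4 := h.le_of_hasChain_between (i := 0) (l := k) (by omega)
        (by rwa [zero_add])
      omega
    · rw [← h1] at hflip0
      linarith
    · have h2 := StrictlyContained.flip E (h.strictlyContained hk0 (by omega)) (a k)
      rw [flip_self] at h2
      have h3 := LE.le.trans_ssubset
        (h.strictlyContained hk0 (by omega)).1 h2
      have h4 := StrictlyContained.form_le_form_right E h3 h1
      linarith
  · have : 0 ≤ (E.form (a 0 : V) (a k)) * (E.form (a k : V) (a (2 * k)) - 1) :=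
      mul_nonneg (by linarith) (by linarith)
    linarith

theorem two_pow_mul_form_sub_one_le (h : E.IsMaxChain n a) {j m : ℕ} (hm : 2 ^ m * j ≤ n) :
    2 ^ m * (E.form (a 0 : V) (a j) - 1) ≤ E.form (a 0 : V) (a (2 ^ m * j)) - 1 := by
  induction m with
  | zero => simp
  | succ m ih =>
    have h1 : 2 ^ (m + 1) * j = 2 * (2 ^ m * j) := by ring
    rw [h1] at hm ⊢
    have h2 := h.two_mul_form_sub_one_le hm
    have h3 := ih (by omega)
    rw [pow_succ]
    linarith

theorem lt_form (h : E.IsMaxChain n a) {j : ℕ} (hj : 1 ≤ j) (hjn : j ≤ n) {ε : ℝ} (hε : 0 < ε)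
    (hf : E.form (a 0 : V) (a j) = 1 + ε) :
    1 + (n : ℝ) / (2 * j) * ε < E.form (a 0 : V) (a n) := by
  set m := Nat.log 2 (n / j)
  have hdiv : n / j ≠ 0 := (Nat.div_pos hjn hj).ne'
  have h1 : 2 ^ m * j ≤ n := (Nat.le_div_iff_mul_le hj).1 (Nat.pow_log_le_self 2 hdiv)
  have h2 : n < 2 ^ (m + 1) * j :=
    (Nat.div_lt_iff_lt_mul hj).1 (Nat.lt_pow_succ_log_self one_lt_two _)
  have h3 := h.two_pow_mul_form_sub_one_le h1
  have h4 := h.form_mono_right (Nat.zero_le _) h1 le_rfl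
  have h5 : (n : ℝ) / (2 * j) < 2 ^ m := by
    have hj' : (0 : ℝ) < j := by exact_mod_cast hj
    rw [div_lt_iff₀ (by positivity)]
    have : (n : ℝ) < 2 ^ (m + 1) * j := by exact_mod_cast h2
    rw [pow_succ] at this
    linarith
  have h6 := mul_lt_mul_of_pos_right h5 hε
  rw [hf, add_sub_cancel_left] at h3
  linarith

end IsMaxChain

end RootBasis

theorem mainTheorem8 {V : Type*} [AddCommGroup V] [Module ℝ V] (E : RootBasis V)
    (hfin : E.simple.Finite) (n : ℕ) (α : Fin (n + 1) → E.roots)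
    (hα : E.IsMaximallyConvex n α) (j : ℕ) (hj : 1 ≤ j) (hjn : j ≤ n) :
    (E.form (α 0 : V) (α ⟨j - 1, by omega⟩ : V) = 1 →
      E.form (α 0 : V) (α ⟨j, by omega⟩ : V) = 1 ∨
        E.form (α 0 : V) (α ⟨j, by omega⟩ : V) ≥ (j : ℝ) * (1 - E.kappa)) ∧
    (∀ ε : ℝ, 0 < ε → E.form (α 0 : V) (α ⟨j, by omega⟩ : V) = 1 + ε →
      E.form (α 0 : V) (α (Fin.last n) : V) > 1 + ((n : ℝ) / (2 * (j : ℝ))) * ε) := by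
  obtain ⟨a, ha, h⟩ : ∃ a : ℕ → E.roots, (∀ (i : ℕ) (hi : i < n + 1), α ⟨i, hi⟩ = a i) ∧
      E.IsMaxChain n a :=
    ⟨_, fun i hi => congrArg α (Fin.ext (min_eq_left (Nat.lt_succ_iff.1 hi)).symm),
      hα.isMaxChain⟩
  have h0 : α 0 = a 0 := ha 0 (Nat.succ_pos n)
  have hl : α (Fin.last n) = a n := ha n (Nat.lt_succ_self n)
  rw [h0, hl, ha (j - 1), ha j]
  refine ⟨fun h1 => ?_, fun ε hε hf => h.lt_form hj hjn hε hf⟩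
  rcases Nat.lt_or_ge j 2 with hj2 | hj2
  · obtain rfl : j = 1 := by omega
    right
    have := h.one_le_form (i := 0) (l := 1) zero_le_one hjn
    push_cast
    linarith [RootBasis.kappa_nonneg (E := E)]
  · obtain ⟨m, rfl⟩ : ∃ m, j = m + 2 := ⟨j - 2, by omega⟩
    by_cases h2 : E.form (a 0 : V) (a (m + 2)) = 1
    · exact .inl h2
    · right
      have := h.le_form_of_form_ne_one hjn h1 h2
      push_cast
      exact this
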